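/- For a (simple) graph $\Gamma$ with vertex set $V(\Gamma)$ and edge set $E(\Gamma)$, let $$A(\Gamma)=\langle\, V(\Gamma)\mid [v,w]=1 \text{ for each } \{v,w\}\in E(\Gamma)\,\rangle$$ be the right-angled Artin group on $\Gamma$. Let $C_4$ be the cycle of length four (the square), and let $F_2$ be the free group of rank two. Then $F_2\times F_2\cong A(C_4)$. Moreover, for every finite graph $\Gamma$, if there is an injective group homomorphism $A(C_4)\to A(\Gamma)$, then $\Gamma$ contains an induced square, that is, an induced subgraph isomorphic to $C_4$. -/

import Mathlib

open scoped commutatorElement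

/-- The defining relators of the right-angled Artin group on `Γ`: the commutators
`[v, w]` in the free group on the vertices, one for each edge `{v, w}` (and orientation). -/
def raagRels {V : Type*} (Γ : SimpleGraph V) : Set (FreeGroup V) :=
  {r | ∃ v w : V, Γ.Adj v w ∧ r = ⁅FreeGroup.of v, FreeGroup.of w⁆}

/-- The right-angled Artin group `A(Γ) = ⟨ V(Γ) | [v, w] = 1 for each edge {v, w} ⟩`. -/
abbrev RAAG {V : Type*} (Γ : SimpleGraph V) : Type _ :=
  PresentedGroup (raagRels Γ)

/-! Opposite vertices of the square generate the two factors of `F₂ × F₂`. For the embedding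
statement, let `f` embed `F₂ × F₂`, with `x, y` a free basis of `F₂`, and set `a = f (x, 1)`, `b = f
(y, 1)`. Each vertex `v` exhibits `A(Γ)` as an HNN extension whose stable letter `v` centralizes the
subgroup of its link. Up to conjugation, `a` is spelled by a cyclically reduced word starting with a
letter `v` that does not commute with `b`. Britton's lemma then shows that any `c` commuting with
`a` satisfies `c ^ n * a ^ k ∈ A(lk v)` for some `n > 0` (`exists_pow_mul_zpow_mem`). Applied to `f
(1, x)` and `f (1, y)`, this puts two noncommuting commutators from the second factor into `A(lk
v)`; both commute with `b`. Since `b` does not commute with `v`, it involves a vertex `v' ≠ v` not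
adjacent to `v`. Britton's lemma for `v'` and a retraction conjugate both commutators into `A(lk v ∩
lk v')`, so `lk v ∩ lk v'` is not a clique, which gives the square (`exists_square`). -/

namespace HNNExtension

/-! ### HNN extensions with central stable letter: Britton's lemma and its consequences. -/

variable {G : Type*} [Group G] {A : Subgroup G}

/-- The HNN extension of `G` whose stable letter centralizes the subgroup `A`. -/
abbrev Central (A : Subgroup G) : Type _ := HNNExtension G A A (MulEquiv.refl A)

/-- The product of the syllables `t ^ u * g`. -/
def syllables (A : Subgroup G) (L : List (ℤˣ × G)) : Central A :=
  (L.map fun x => t ^ (x.1 : ℤ) * of x.2).prod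

/-- A list of syllables without a pinch `t ^ u * g * t ^ (-u)` with `g ∈ A`. -/
def NoPinch (A : Subgroup G) (L : List (ℤˣ × G)) : Prop :=
  L.IsChain fun a b => a.2 ∈ A → a.1 = b.1

@[simp]
theorem syllables_nil : syllables A [] = 1 := rfl

@[simp]
theorem syllables_cons (x : ℤˣ × G) (L : List (ℤˣ × G)) :
    syllables A (x :: L) = t ^ (x.1 : ℤ) * of x.2 * syllables A L := by
  simp [syllables]

@[simp]
theorem syllables_append (L L' : List (ℤˣ × G)) :
    syllables A (L ++ L') = syllables A L * syllables A L' := by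
  simp [syllables]

theorem toSubgroup_self (u : ℤˣ) : toSubgroup A A u = A := by
  simp [toSubgroup]

theorem commute_t_of {g : G} (hg : g ∈ A) : Commute (t : Central A) (of g) :=
  t_mul_of (φ := MulEquiv.refl A) ⟨g, hg⟩

theorem britton {h₁ h₂ : G} {L₁ L₂ : List (ℤˣ × G)} (hL₁ : NoPinch A L₁) (hL₂ : NoPinch A L₂)
    (h : of h₁ * syllables A L₁ = of h₂ * syllables A L₂) :
    L₁.map Prod.fst = L₂.map Prod.fst ∧ (L₁ ≠ [] → h₁⁻¹ * h₂ ∈ A) := by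
  have key := ReducedWord.map_fst_eq_and_of_prod_eq (MulEquiv.refl A)
    (w₁ := ⟨h₁, L₁, by simpa only [toSubgroup_self, NoPinch] using hL₁⟩)
    (w₂ := ⟨h₂, L₂, by simpa only [toSubgroup_self, NoPinch] using hL₂⟩) h
  refine ⟨key.1, fun hne => ?_⟩
  obtain ⟨x, L, rfl⟩ := List.exists_cons_of_ne_nil hne
  simpa only [toSubgroup_self] using key.2 x.1 (by simp)

theorem exists_noPinch (c : Central A) :
    ∃ h L, NoPinch A L ∧ of h * syllables A L = c := by
  obtain ⟨d⟩ := NormalWord.TransversalPair.nonempty G A A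
  let w := NormalWord.equiv (MulEquiv.refl A) d c
  refine ⟨w.head, w.toList, by simpa only [toSubgroup_self, NoPinch] using w.chain, ?_⟩
  exact (NormalWord.equiv (MulEquiv.refl A) d).symm_apply_apply c

theorem central_induction {P : Central A → Prop} (hof : ∀ g, P (of g))
    (ht : ∀ u : ℤˣ, P (t ^ (u : ℤ))) (hmul : ∀ x y, P x → P y → P (x * y)) (c : Central A) :
    P c := by
  obtain ⟨h, L, -, rfl⟩ := exists_noPinch c
  refine hmul _ _ (hof h) ?_
  induction L with
  | nil => simpa using hof 1
  | cons x L ih => simpa using hmul _ _ (hmul _ _ (ht x.1) (hof x.2)) ih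

/-- An element outside the base group carries all base elements commuting with it into a single
conjugate of the associated subgroup. -/
theorem exists_conj_mem_of_commute {b : Central A} (hb : b ∉ (of : G →* Central A).range) :
    ∃ g : G, ∀ c : G, Commute b (of c) → g⁻¹ * c * g ∈ A := by
  obtain ⟨h, L, hL, rfl⟩ := exists_noPinch b
  have hne : L ≠ [] := by
    rintro rfl
    exact hb ⟨h, by simp⟩
  refine ⟨h, fun c hc => ?_⟩
  obtain ⟨L', x, rfl⟩ := L.eq_nil_or_concat'.resolve_left hne
  -- Absorbing `c` into the last coefficient keeps the word reduced. So `b * c` and `c * b` have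
  -- reduced forms with heads `h` and `c * h`, which Britton's lemma compares.
  have hL' : NoPinch A (L' ++ [(x.1, x.2 * c)]) := by
    simp only [NoPinch, List.isChain_append] at hL ⊢
    simpa using hL
  have := (britton hL' hL (h₁ := h) (h₂ := c * h) (by
    simpa [mul_assoc] using hc.eq)).2 (by simp)
  simpa [mul_assoc] using this

/-- Prefixes of two reduced expressions of the same element lie in the same cosets of `A`. -/
theorem prefix_coset {h₁ h₂ : G} {L₁ L₂ : List (ℤˣ × G)} (hL₁ : NoPinch A L₁)
    (hL₂ : NoPinch A L₂) (h : of h₁ * syllables A L₁ = of h₂ * syllables A L₂) {j : ℕ}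
    (hj : j < L₁.length) :
    ∃ a ∈ A, of h₂ * syllables A (L₂.take j) = of h₁ * syllables A (L₁.take j) * of a := by
  induction j generalizing h₁ h₂ L₁ L₂ with
  | zero =>
    refine ⟨_, (britton hL₁ hL₂ h).2 (by rintro rfl; simp at hj), ?_⟩
    simp
  | succ j ih =>
    obtain ⟨hm, hA⟩ := britton hL₁ hL₂ h
    cases L₁ with
    | nil => simp at hj
    | cons x₁ L₁ =>
    cases L₂ with
    | nil => simp at hm
    | cons x₂ L₂ =>
    obtain ⟨u, g₁⟩ := x₁
    obtain ⟨u', g₂⟩ := x₂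
    obtain ⟨rfl, -⟩ : u = u' ∧ _ := by simpa using hm
    specialize hA (by simp)
    have hcomm : Commute (t ^ (u : ℤ) : Central A) (of (h₁⁻¹ * h₂)) :=
      (commute_t_of hA).zpow_left _
    have e : (of h₂ * t ^ (u : ℤ) : Central A) = of h₁ * t ^ (u : ℤ) * of (h₁⁻¹ * h₂) := by
      rw [mul_assoc, hcomm.eq]
      simp [mul_assoc]
    -- The discrepancy `h₁⁻¹ * h₂ ∈ A` slides past the stable letter into the next coefficient.
    obtain ⟨a, ha, h'⟩ := ih (h₁ := g₁) (h₂ := h₁⁻¹ * h₂ * g₂) (L₁ := L₁) (L₂ := L₂)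
      (List.isChain_cons.1 hL₁).2 (List.isChain_cons.1 hL₂).2 (by
        simp only [syllables_cons, ← mul_assoc, e] at h
        apply mul_left_cancel (a := of h₁ * t ^ (u : ℤ))
        simp only [← mul_assoc, h, map_mul]) (by simpa using hj)
    refine ⟨a, ha, ?_⟩
    simp only [List.take_succ_cons, syllables_cons, ← mul_assoc, e]
    rw [mul_assoc (of h₁ * t ^ (u : ℤ)), mul_assoc (of h₁ * t ^ (u : ℤ)), ← map_mul, h']
    simp only [mul_assoc]

theorem NoPinch.concat_congr {L : List (ℤˣ × G)} {u : ℤˣ} {g : G} (h : NoPinch A (L ++ [(u, g)]))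
    (g' : G) : NoPinch A (L ++ [(u, g')]) := by
  simp only [NoPinch, List.isChain_append] at h ⊢
  simpa using h

/-- Left multiplication by a fixed element disturbs only boundedly many initial syllables; the
length bound keeps cancellation from exhausting the word. -/
theorem exists_mul_left_suffix (c : Central A) :
    ∃ M, ∀ h L, NoPinch A L → M ≤ L.length → ∃ h' L', NoPinch A L' ∧
      of h' * syllables A L' = c * (of h * syllables A L) ∧
      ∃ s ≤ M, ∃ r ≤ M, L'.drop s = L.drop r := by
  induction c using central_induction with
  | hof g =>
    exact ⟨0, fun h L hL _ => ⟨g * h, L, hL, by simp [mul_assoc], 0, le_rfl, 0, le_rfl, rfl⟩⟩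
  | ht u =>
    refine ⟨1, fun h L hL hlen => ?_⟩
    obtain ⟨x, L, rfl⟩ := List.exists_cons_of_length_pos hlen
    by_cases hx : h ∈ A → u = x.1
    · exact ⟨1, (u, h) :: x :: L, List.isChain_cons_cons.2 ⟨hx, hL⟩, by simp [mul_assoc],
        1, le_rfl, 0, zero_le_one, rfl⟩
    · push Not at hx
      obtain ⟨hA, hx⟩ := hx
      refine ⟨h * x.2, L, (List.isChain_cons.1 hL).2, ?_, 0, zero_le_one, 1, le_rfl, rfl⟩
      have : x.1 = -u := by
        rcases Int.units_eq_one_or u with rfl | rfl <;>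
        rcases Int.units_eq_one_or x.1 with h | h <;> simp_all
      have hc := ((commute_t_of hA).zpow_left (u : ℤ)).eq
      simp only [syllables_cons, this, map_mul, ← mul_assoc, hc, Units.val_neg, zpow_neg]
      simp
  | hmul x y hx hy =>
    obtain ⟨M₁, hx⟩ := hx
    obtain ⟨M₂, hy⟩ := hy
    refine ⟨M₁ + M₂, fun h L hL hlen => ?_⟩
    obtain ⟨h₁, L₁, hL₁, e₁, s₁, hs₁, r₁, hr₁, d₁⟩ := hy h L hL (by omega)
    have hl := congrArg List.length d₁
    simp only [List.length_drop] at hl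
    obtain ⟨h₂, L₂, hL₂, e₂, s₂, hs₂, r₂, hr₂, d₂⟩ := hx h₁ L₁ hL₁ (by omega)
    refine ⟨h₂, L₂, hL₂, by rw [e₂, e₁, mul_assoc], s₂ + s₁, by omega, r₁ + r₂, by omega, ?_⟩
    rw [← List.drop_drop, d₂, List.drop_drop, add_comm, ← List.drop_drop, d₁, List.drop_drop]

theorem exists_mul_right_prefix (c : Central A) :
    ∃ M, ∀ L, NoPinch A L → M ≤ L.length → ∃ L', NoPinch A L' ∧
      syllables A L' = syllables A L * c ∧ ∀ j, j + M ≤ L.length → L'.take j = L.take j := by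
  induction c using central_induction with
  | hof g =>
    refine ⟨1, fun L hL hlen => ?_⟩
    obtain ⟨L, ⟨u, k⟩, rfl⟩ := L.eq_nil_or_concat'.resolve_left (by rintro rfl; simp at hlen)
    refine ⟨L ++ [(u, k * g)], hL.concat_congr _, by simp [mul_assoc], fun j hj => ?_⟩
    have : j ≤ L.length := by simpa using hj
    rw [List.take_append_of_le_length this, List.take_append_of_le_length this]
  | ht u =>
    -- Cancelling the last syllable leaves its coefficient to be absorbed by the previous one, so
    -- two syllables must be present.
    refine ⟨2, fun L hL hlen => ?_⟩
    obtain ⟨L, ⟨e, k⟩, rfl⟩ := L.eq_nil_or_concat'.resolve_left (by rintro rfl; simp at hlen)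
    by_cases hx : k ∈ A → e = u
    · refine ⟨L ++ [(e, k)] ++ [(u, 1)], ?_, by simp [mul_assoc], fun j hj => ?_⟩
      · refine List.isChain_append.2 ⟨hL, List.isChain_singleton _, ?_⟩
        simpa using hx
      · rw [List.take_append_of_le_length (by omega)]
    · push Not at hx
      obtain ⟨hA, hx⟩ := hx
      obtain ⟨L, ⟨f, l⟩, rfl⟩ := L.eq_nil_or_concat'.resolve_left (by rintro rfl; simp at hlen)
      refine ⟨L ++ [(f, l * k)], NoPinch.concat_congr (List.isChain_append.1 hL).1 _, ?_,
        fun j hj => ?_⟩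
      · have : e = -u := by
          rcases Int.units_eq_one_or u with rfl | rfl <;>
          rcases Int.units_eq_one_or e with rfl | rfl <;> simp_all
        have hc := ((commute_t_of hA).zpow_left (u : ℤ)).eq
        simp only [this, syllables_append, syllables_cons, syllables_nil, map_mul, mul_assoc, mul_one,
          ← hc, Units.val_neg, zpow_neg]
        simp
      · have : j ≤ L.length := by simpa using hj
        rw [List.append_assoc, List.take_append_of_le_length this,
          List.take_append_of_le_length this]
  | hmul x y hx hy =>
    obtain ⟨M₁, hx⟩ := hx
    obtain ⟨M₂, hy⟩ := hy
    refine ⟨M₁ + M₂, fun L hL hlen => ?_⟩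
    obtain ⟨L₁, hL₁, e₁, p₁⟩ := hx L hL (by omega)
    have hl := congrArg List.length (p₁ (L.length - M₁) (by omega))
    simp only [List.length_take] at hl
    obtain ⟨L₂, hL₂, e₂, p₂⟩ := hy L₁ hL₁ (by omega)
    exact ⟨L₂, hL₂, by rw [e₂, e₁, mul_assoc], fun j hj =>
      (p₂ j (by omega)).trans (p₁ j (by omega))⟩

/-! ### Periodic words and centralizers of cyclically reduced elements. -/

/-- The `N`-fold repetition of a list. -/
def repeated {α : Type*} (L : List α) (N : ℕ) : List α := (List.replicate N L).flatten

theorem repeated_add {α : Type*} (L : List α) (m n : ℕ) :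
    repeated L (m + n) = repeated L m ++ repeated L n := by
  rw [repeated, List.replicate_add, List.flatten_append]
  rfl

theorem length_repeated {α : Type*} (L : List α) (n : ℕ) :
    (repeated L n).length = n * L.length := by
  simp [repeated]

theorem syllables_repeated (L : List (ℤˣ × G)) (n : ℕ) :
    syllables A (repeated L n) = syllables A L ^ n := by
  induction n with
  | zero => simp [repeated]
  | succ n ih => rw [repeated_add, syllables_append, ih, pow_succ]; simp [repeated]

theorem take_repeated {α : Type*} (L : List α) {k N : ℕ} (h : k ≤ N) :
    (repeated L N).take (k * L.length) = repeated L k := by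
  obtain ⟨m, rfl⟩ := Nat.exists_eq_add_of_le h
  rw [repeated_add, List.take_left' (length_repeated L k)]

theorem exists_take_repeated {α : Type*} (L : List α) {i N : ℕ} (h : i < N * L.length) :
    ∃ q, ∃ r < L.length, (repeated L N).take i = repeated L q ++ L.take r := by
  have hL : 0 < L.length := Nat.pos_of_ne_zero (by rintro h0; simp [h0] at h)
  have hq : i / L.length < N := (Nat.div_lt_iff_lt_mul hL).2 h
  obtain ⟨m, rfl⟩ := Nat.exists_eq_add_of_lt hq
  refine ⟨i / L.length, i % L.length, Nat.mod_lt _ hL, ?_⟩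
  have hi : i = (repeated L (i / L.length)).length + i % L.length := by
    rw [length_repeated, mul_comm, Nat.div_add_mod]
  generalize i / L.length = q at *
  generalize hρ : i % L.length = ρ at *
  have hlt : ρ < L.length := hρ ▸ Nat.mod_lt _ hL
  rw [hi, add_assoc, repeated_add, List.take_length_add_append, add_comm m, repeated_add]
  have : repeated L 1 = L := by simp [repeated]
  rw [this, List.take_append_of_le_length hlt.le]

/-- The extra syllable `(x.1, 1)` tests the seam between consecutive copies; its coefficient plays
no role. -/
theorem noPinch_repeated {x : ℤˣ × G} {L : List (ℤˣ × G)}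
    (h : NoPinch A (x :: L ++ [(x.1, 1)])) (N : ℕ) : NoPinch A (repeated (x :: L) N) := by
  induction N with
  | zero => exact List.isChain_nil
  | succ N ih =>
    rw [add_comm, repeated_add]
    have : repeated (x :: L) 1 = x :: L := by simp [repeated]
    rw [this]
    simp only [NoPinch, List.isChain_append] at h ⊢
    refine ⟨h.1, ih, fun y hy z hz => ?_⟩
    have := h.2.2 y hy (x.1, 1) (by simp)
    cases N with
    | zero => simp [repeated] at hz
    | succ N =>
      have : z = x := by
        simpa [repeated, List.replicate_succ] using hz.symm
      simp_all

/-- An element centralizing a cyclically reduced `a` has a power which agrees with a power of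
`a` up to the associated subgroup. -/
theorem exists_pow_mul_zpow_mem {x : ℤˣ × G} {L : List (ℤˣ × G)}
    (hL : NoPinch A (x :: L ++ [(x.1, 1)])) {c : Central A}
    (hc : Commute c (syllables A (x :: L))) :
    ∃ n : ℕ, 0 < n ∧ ∃ k : ℤ, ∃ g ∈ A, c ^ n * syllables A (x :: L) ^ k = of g := by
  set W := x :: L with hW
  set a := syllables A W
  have hpos : 0 < W.length := by simp [hW]
  -- Modulo powers of `a`, the centralizer of `a` meets only finitely many cosets of `A`,
  -- represented by prefixes of `W`.
  have key : ∀ c : Central A, Commute c a → ∃ r : Fin W.length, ∃ k : ℤ, ∃ g ∈ A,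
      c * a ^ k = syllables A (W.take r) * of g := by
    intro c hc
    obtain ⟨M₁, h₁⟩ := exists_mul_left_suffix c
    obtain ⟨M₂, h₂⟩ := exists_mul_right_prefix c
    -- With this `N`, the end of the initial `a ^ M₁` in `a ^ N` lies past the syllables disturbed
    -- by `c` on the left and, even after a shift by `M₁`, before those disturbed on the right.
    set N := M₁ + M₁ + M₂ + 1
    have hNW : N ≤ N * W.length := Nat.le_mul_of_pos_right _ hpos
    have hlen := length_repeated W N
    have hred := noPinch_repeated hL N
    obtain ⟨h', L₁, hL₁, e₁, s, hs, r, hr, d⟩ := h₁ 1 (repeated W N) hred (by omega)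
    obtain ⟨L₂, hL₂, e₂, p⟩ := h₂ (repeated W N) hred (by omega)
    have hMW : M₁ ≤ M₁ * W.length := Nat.le_mul_of_pos_right _ hpos
    have hNM : N * W.length = M₁ * W.length + (M₁ + M₂ + 1) * W.length := by
      rw [← add_mul]; congr 1; omega
    have hMM : M₁ + M₂ + 1 ≤ (M₁ + M₂ + 1) * W.length := Nat.le_mul_of_pos_right _ hpos
    obtain ⟨j, hj⟩ := Nat.exists_eq_add_of_le (hr.trans hMW)
    have hld := congrArg List.length d
    simp only [List.length_drop] at hld
    -- the prefix of `L₁` ending where the prefix `a ^ M₁` of the repeated word ends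
    have hpre : of h' * syllables A (L₁.take (s + j)) = c * a ^ M₁ := by
      have e3 : L₁.drop (s + j) = (repeated W N).drop (r + j) := by
        rw [← List.drop_drop, d, List.drop_drop]
      have e4 : syllables A L₁ = syllables A (L₁.take (s + j)) * syllables A (L₁.drop (s + j)) := by
        rw [← syllables_append, List.take_append_drop]
      have e5 : syllables A (repeated W N) = a ^ M₁ * syllables A ((repeated W N).drop (r + j)) := by
        rw [← syllables_repeated, ← take_repeated W (by omega : M₁ ≤ N), hj, ← syllables_append,
          List.take_append_drop]
      rw [e4, e5, e3] at e₁
      simpa [← mul_assoc] using e₁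
    have hcomm : of h' * syllables A L₁ = of 1 * syllables A L₂ := by
      rw [e₁, e₂, syllables_repeated]
      simpa using (hc.pow_right N).eq
    obtain ⟨g, hg, e⟩ := prefix_coset hL₁ hL₂ hcomm (j := s + j) (by omega)
    rw [hpre, p (s + j) (by omega)] at e
    obtain ⟨q, ρ, hρ, e'⟩ := exists_take_repeated W (i := s + j) (N := N) (by omega)
    rw [e', syllables_append, syllables_repeated] at e
    refine ⟨⟨ρ, hρ⟩, M₁ - q, g⁻¹, inv_mem hg, ?_⟩
    have e6 : c * a ^ M₁ = a ^ q * (syllables A (W.take ρ) * of g⁻¹) := by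
      simp only [map_one, one_mul] at e
      rw [← mul_assoc, e]
      simp [mul_assoc]
    have hcq : c * a ^ ((M₁ : ℤ) - q) = (a ^ q)⁻¹ * (c * a ^ M₁) := by
      rw [← mul_assoc, ← ((hc.pow_right q).inv_right).eq, mul_assoc, sub_eq_neg_add, zpow_add]
      simp
    rw [hcq, e6]
    simp
  -- Pigeonhole: two powers of `c` share the same prefix, which cancels in their quotient.
  choose r k g hg e using fun i : ℕ => key (c ^ i) (hc.pow_left i)
  obtain ⟨i, j, hij, hr⟩ : ∃ i j, i < j ∧ r i = r j := by
    obtain ⟨i, j, hne, h⟩ := Finite.exists_ne_map_eq_of_infinite r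
    rcases hne.lt_or_gt with h' | h'
    exacts [⟨i, j, h', h⟩, ⟨j, i, h', h.symm⟩]
  refine ⟨j - i, by omega, k j - k i, (g i)⁻¹ * g j, mul_mem (inv_mem (hg i)) (hg j), ?_⟩
  have hi := e i
  rw [hr] at hi
  have : of ((g i)⁻¹ * g j) = (c ^ i * a ^ k i)⁻¹ * (c ^ j * a ^ k j) := by
    rw [hi, e j]
    simp [mul_assoc]
  obtain ⟨m, rfl⟩ := Nat.exists_eq_add_of_le hij.le
  rw [this, Nat.add_sub_cancel_left, pow_add, sub_eq_neg_add, zpow_add, ← mul_assoc,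
    ((hc.pow_left m).zpow_right (-k i)).eq, zpow_neg]
  group

end HNNExtension

namespace RAAG

/-! ### Right-angled Artin groups: parabolic subgroups and retractions. -/

theorem commute_conj_iff {G : Type*} [Group G] (g a b : G) :
    Commute (g * a * g⁻¹) (g * b * g⁻¹) ↔ Commute a b := by
  simp

variable {V : Type*} {Γ : SimpleGraph V}

/-- The generator of `A(Γ)` attached to a vertex. -/
def gen (Γ : SimpleGraph V) (v : V) : RAAG Γ := PresentedGroup.of v

theorem commute_gen {v w : V} (h : Γ.Adj v w) : Commute (gen Γ v) (gen Γ w) := by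
  rw [← commutatorElement_eq_one_iff_commute]
  have := PresentedGroup.one_of_mem (rels := raagRels Γ) ⟨v, w, h, rfl⟩
  rwa [map_commutatorElement] at this

/-- The homomorphism out of `A(Γ)` given by commuting images of adjacent vertices. -/
def lift {H : Type*} [Group H] (f : V → H) (hf : ∀ v w, Γ.Adj v w → Commute (f v) (f w)) :
    RAAG Γ →* H :=
  PresentedGroup.toGroup (f := f) (by
    rintro _ ⟨v, w, h, rfl⟩
    simpa [commutatorElement_eq_one_iff_commute] using hf v w h)

@[simp]
theorem lift_gen {H : Type*} [Group H] (f : V → H)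
    (hf : ∀ v w, Γ.Adj v w → Commute (f v) (f w)) (v : V) : lift f hf (gen Γ v) = f v :=
  PresentedGroup.toGroup.of _

theorem hom_ext {H : Type*} [Group H] {f g : RAAG Γ →* H} (h : ∀ v, f (gen Γ v) = g (gen Γ v)) :
    f = g :=
  PresentedGroup.ext h

/-- The standard parabolic subgroup generated by a set of vertices. -/
def par (Γ : SimpleGraph V) (S : Set V) : Subgroup (RAAG Γ) := Subgroup.closure (gen Γ '' S)

theorem gen_mem_par {S : Set V} {v : V} (h : v ∈ S) : gen Γ v ∈ par Γ S :=
  Subgroup.subset_closure ⟨v, h, rfl⟩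

theorem par_mono {S T : Set V} (h : S ⊆ T) : par Γ S ≤ par Γ T :=
  Subgroup.closure_mono (Set.image_mono h)

theorem par_univ : par Γ Set.univ = ⊤ := by
  rw [par, Set.image_univ]
  exact PresentedGroup.closure_range_of _

theorem commute_of_mem_par {S : Set V} {x y : RAAG Γ} (h : ∀ v ∈ S, Commute (gen Γ v) x)
    (hy : y ∈ par Γ S) : Commute y x := by
  have : par Γ S ≤ Subgroup.centralizer {x} := by
    rw [par, Subgroup.closure_le]
    rintro _ ⟨v, hv, rfl⟩
    rw [SetLike.mem_coe, Subgroup.mem_centralizer_singleton_iff]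
    exact (h v hv).eq
  exact Subgroup.mem_centralizer_singleton_iff.1 (this hy)

theorem commute_gen_of_mem_par_neighborSet {v : V} {x : RAAG Γ}
    (hx : x ∈ par Γ (Γ.neighborSet v)) : Commute x (gen Γ v) :=
  commute_of_mem_par (fun _ hw => commute_gen (Γ.adj_symm hw)) hx

theorem commute_of_mem_par_of_isClique {S : Set V} (hS : Γ.IsClique S) {x y : RAAG Γ}
    (hx : x ∈ par Γ S) (hy : y ∈ par Γ S) : Commute x y := by
  refine commute_of_mem_par (fun v hv => (commute_of_mem_par (fun w hw => ?_) hy).symm) hx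
  by_cases h : w = v
  · subst h; exact Commute.refl _
  · exact commute_gen (hS hw hv h)

open Classical in
/-- The endomorphism of `A(Γ)` killing the vertices outside `S`. -/
noncomputable def retract (Γ : SimpleGraph V) (S : Set V) : RAAG Γ →* RAAG Γ :=
  lift (fun v => if v ∈ S then gen Γ v else 1) fun v w h => by
    split_ifs
    exacts [commute_gen h, Commute.one_right _, Commute.one_left _, Commute.one_left _]

theorem retract_gen_of_mem {S : Set V} {v : V} (h : v ∈ S) :
    retract Γ S (gen Γ v) = gen Γ v := by
  simp [retract, h]

theorem retract_gen_of_notMem {S : Set V} {v : V} (h : v ∉ S) :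
    retract Γ S (gen Γ v) = 1 := by
  simp [retract, h]

theorem retract_eq_self {S : Set V} {x : RAAG Γ} (hx : x ∈ par Γ S) : retract Γ S x = x := by
  have : par Γ S ≤ (retract Γ S).eqLocus (MonoidHom.id _) := by
    rw [par, Subgroup.closure_le]
    rintro _ ⟨v, hv, rfl⟩
    exact retract_gen_of_mem hv
  exact this hx

theorem retract_mem {S T : Set V} {x : RAAG Γ} (hx : x ∈ par Γ T) :
    retract Γ S x ∈ par Γ (S ∩ T) := by
  have : par Γ T ≤ (par Γ (S ∩ T)).comap (retract Γ S) := by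
    rw [par, Subgroup.closure_le]
    rintro _ ⟨v, hv, rfl⟩
    rw [SetLike.mem_coe, Subgroup.mem_comap]
    by_cases h : v ∈ S
    · rw [retract_gen_of_mem h]
      exact gen_mem_par ⟨h, hv⟩
    · rw [retract_gen_of_notMem h]
      exact one_mem _
  exact this hx

theorem mem_par_inter {S T : Set V} {x : RAAG Γ} (hS : x ∈ par Γ S) (hT : x ∈ par Γ T) :
    x ∈ par Γ (S ∩ T) := by
  rw [← retract_eq_self hS]
  exact retract_mem hT

/-! ### The HNN splitting at a vertex, and the criterion for an induced square. -/

/-- The link subgroup of `v` inside the parabolic subgroup on the vertices different from `v`. -/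
def link (Γ : SimpleGraph V) (v : V) : Subgroup (par Γ {v}ᶜ) :=
  (par Γ (Γ.neighborSet v)).subgroupOf (par Γ {v}ᶜ)

open HNNExtension

open Classical in
/-- `A(Γ)` as an HNN extension with stable letter `v`. -/
noncomputable def toHNN (Γ : SimpleGraph V) (v : V) : RAAG Γ →* Central (link Γ v) :=
  lift (fun u => if h : u = v then t else of ⟨gen Γ u, gen_mem_par (Set.mem_compl_singleton_iff.2 h)⟩) fun u w h => by
    split_ifs with h₁ h₂ h₂
    · exact Commute.refl _
    · subst h₁
      exact commute_t_of (Subgroup.mem_subgroupOf.2 (gen_mem_par h))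
    · subst h₂
      exact (commute_t_of (Subgroup.mem_subgroupOf.2 (gen_mem_par (Γ.adj_symm h)))).symm
    · exact Commute.map (Subtype.ext (commute_gen h).eq) of

/-- The homomorphism from the HNN extension with stable letter `v` back to `A(Γ)`. -/
def ofHNN (Γ : SimpleGraph V) (v : V) : Central (link Γ v) →* RAAG Γ :=
  HNNExtension.lift (par Γ {v}ᶜ).subtype (gen Γ v) fun a =>
    (commute_gen_of_mem_par_neighborSet (Subgroup.mem_subgroupOf.1 a.2)).eq.symm

@[simp]
theorem toHNN_gen_self (v : V) : toHNN Γ v (gen Γ v) = t := by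
  simp [toHNN]

theorem toHNN_gen_of_ne {u v : V} (h : u ≠ v) :
    toHNN Γ v (gen Γ u) = of ⟨gen Γ u, gen_mem_par (Set.mem_compl_singleton_iff.2 h)⟩ := by
  simp [toHNN, h]

@[simp]
theorem ofHNN_toHNN (v : V) (x : RAAG Γ) : ofHNN Γ v (toHNN Γ v x) = x := by
  have : (ofHNN Γ v).comp (toHNN Γ v) = MonoidHom.id _ := hom_ext fun u => by
    by_cases h : u = v
    · subst h
      simpa [ofHNN] using HNNExtension.lift_t _ _ _
    · rw [MonoidHom.comp_apply, toHNN_gen_of_ne h]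
      exact HNNExtension.lift_of _ _ _ _
  exact DFunLike.congr_fun this x

theorem ofHNN_of (v : V) (x : par Γ {v}ᶜ) : ofHNN Γ v (of x) = x :=
  HNNExtension.lift_of _ _ _ _

theorem toHNN_injective (v : V) : Function.Injective (toHNN Γ v) :=
  Function.LeftInverse.injective (ofHNN_toHNN v)

theorem toHNN_coe (v : V) (x : par Γ {v}ᶜ) : toHNN Γ v x = of x := by
  obtain ⟨x, hx⟩ := x
  have : par Γ {v}ᶜ ≤
      ((of : _ →* Central (link Γ v)).range).comap (toHNN Γ v) := by
    conv_lhs => rw [par]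
    rw [Subgroup.closure_le]
    rintro _ ⟨u, hu, rfl⟩
    exact ⟨_, (toHNN_gen_of_ne hu).symm⟩
  obtain ⟨y, hy⟩ := this hx
  have := congrArg (ofHNN Γ v) hy
  rw [ofHNN_toHNN, ofHNN_of] at this
  rw [← hy]
  congr 1
  exact Subtype.ext this

/-- An element outside the parabolic subgroup on the complement of `v` carries all elements of that
subgroup commuting with it into a single conjugate of the link subgroup of `v`. -/
theorem exists_conj_mem_par_neighborSet {v : V} {b : RAAG Γ} (hb : b ∉ par Γ {v}ᶜ) :
    ∃ g, ∀ c ∈ par Γ {v}ᶜ, Commute b c → g⁻¹ * c * g ∈ par Γ (Γ.neighborSet v) := by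
  obtain ⟨g, hg⟩ := exists_conj_mem_of_commute (A := link Γ v) (b := toHNN Γ v b) (by
    rintro ⟨x, hx⟩
    have := congrArg (ofHNN Γ v) hx
    rw [ofHNN_toHNN, ofHNN_of] at this
    exact hb (this ▸ x.2))
  refine ⟨g, fun c hc h => ?_⟩
  have := hg ⟨c, hc⟩ (by
    rw [← toHNN_coe]
    exact h.map _)
  simpa [link, Subgroup.mem_subgroupOf] using this

/-- Noncommuting elements of the link subgroup of `v`, both commuting with an element that does not
commute with `v`, force an induced square. -/
theorem exists_square [Finite V] {v : V} {b c d : RAAG Γ} (hb : ¬ Commute b (gen Γ v))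
    (hc : c ∈ par Γ (Γ.neighborSet v)) (hd : d ∈ par Γ (Γ.neighborSet v)) (hcd : ¬ Commute c d)
    (hbc : Commute b c) (hbd : Commute b d) :
    ∃ v' w w', v ≠ v' ∧ ¬ Γ.Adj v v' ∧ w ≠ w' ∧ ¬ Γ.Adj w w' ∧
      Γ.Adj v w ∧ Γ.Adj v w' ∧ Γ.Adj v' w ∧ Γ.Adj v' w' := by
  obtain ⟨v', hne, hadj, hb'⟩ : ∃ v', v ≠ v' ∧ ¬ Γ.Adj v v' ∧ b ∉ par Γ {v'}ᶜ := by
    by_contra! H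
    -- Otherwise, intersecting parabolics would place `b` in the subgroup on the star of `v`, which
    -- centralizes `v`.
    have key : ∀ T : Set V, T.Finite → (∀ u ∈ T, v ≠ u ∧ ¬ Γ.Adj v u) → b ∈ par Γ Tᶜ := by
      intro T hT
      induction T, hT using Set.Finite.induction_on with
      | empty => simp [par_univ]
      | @insert u T _ _ ih =>
        intro hu
        have := mem_par_inter (H u (hu u (by simp)).1 (hu u (by simp)).2)
          (ih fun w hw => hu w (by simp [hw]))
        rwa [← Set.compl_union] at this
    refine hb (commute_of_mem_par (fun u hu => ?_)
      (key {u | v ≠ u ∧ ¬ Γ.Adj v u} (Set.toFinite _) fun u hu => hu))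
    by_cases h : v = u
    · subst h; exact Commute.refl _
    · by_contra h'
      exact hu ⟨h, fun h'' => h' (commute_gen h''.symm)⟩
  obtain ⟨g, hg⟩ := exists_conj_mem_par_neighborSet hb'
  have hsub : Γ.neighborSet v ⊆ {v'}ᶜ := by
    rintro u hu rfl
    exact hadj hu
  -- Retracting to the link of `v` fixes `x` and replaces the conjugator by its image, the same one
  -- for all `x`.
  have key : ∀ x ∈ par Γ (Γ.neighborSet v), Commute b x →
      (retract Γ (Γ.neighborSet v) g)⁻¹ * x * retract Γ (Γ.neighborSet v) g ∈
        par Γ (Γ.neighborSet v ∩ Γ.neighborSet v') := by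
    intro x hx h
    have := retract_mem (S := Γ.neighborSet v) (hg x (par_mono hsub hx) h)
    simpa [retract_eq_self hx] using this
  by_contra! H
  refine hcd ((commute_conj_iff (retract Γ (Γ.neighborSet v) g)⁻¹ c d).1 ?_)
  rw [inv_inv]
  refine commute_of_mem_par_of_isClique ?_ (key c hc hbc) (key d hd hbd)
  intro w hw w' hw' hww
  by_contra h
  exact H v' w w' hne hadj hww h hw.1 hw'.1 hw.2 hw'.2

end RAAG

namespace RAAG

/-! ### Words in the generators and cyclic reduction. -/

open HNNExtension

variable {V : Type*} {Γ : SimpleGraph V}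

/-- The element of `A(Γ)` spelled by a word in the generators and their inverses. -/
def eval (Γ : SimpleGraph V) (l : List (V × ℤˣ)) : RAAG Γ :=
  (l.map fun p => gen Γ p.1 ^ (p.2 : ℤ)).prod

@[simp]
theorem eval_nil : eval Γ [] = 1 := rfl

@[simp]
theorem eval_cons (p : V × ℤˣ) (l : List (V × ℤˣ)) :
    eval Γ (p :: l) = gen Γ p.1 ^ (p.2 : ℤ) * eval Γ l := by
  simp [eval]

@[simp]
theorem eval_append (l l' : List (V × ℤˣ)) : eval Γ (l ++ l') = eval Γ l * eval Γ l' := by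
  simp [eval]

theorem eval_surjective : Function.Surjective (eval Γ) := by
  intro x
  have hx : x ∈ par Γ Set.univ := by simp [par_univ]
  induction hx using Subgroup.closure_induction_left with
  | one => exact ⟨[], rfl⟩
  | mul_left x hx y _ ih =>
    obtain ⟨v, -, rfl⟩ := hx
    obtain ⟨l, rfl⟩ := ih
    exact ⟨(v, 1) :: l, by simp⟩
  | inv_mul_cancel x hx y _ ih =>
    obtain ⟨v, -, rfl⟩ := hx
    obtain ⟨l, rfl⟩ := ih
    exact ⟨(v, -1) :: l, by simp⟩

open Classical in
/-- Cutting a word at the occurrences of `v`. -/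
noncomputable def split (Γ : SimpleGraph V) (v : V) :
    List (V × ℤˣ) → par Γ {v}ᶜ × List (ℤˣ × par Γ {v}ᶜ)
  | [] => (1, [])
  | (u, e) :: l =>
    if h : u = v then (1, (e, (split Γ v l).1) :: (split Γ v l).2)
    else (⟨gen Γ u, gen_mem_par (Set.mem_compl_singleton_iff.2 h)⟩ ^ (e : ℤ) * (split Γ v l).1,
      (split Γ v l).2)

theorem split_cons_self (v : V) (e : ℤˣ) (l : List (V × ℤˣ)) :
    split Γ v ((v, e) :: l) = (1, (e, (split Γ v l).1) :: (split Γ v l).2) := by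
  simp [split]

theorem split_cons_of_ne {u v : V} (h : u ≠ v) (e : ℤˣ) (l : List (V × ℤˣ)) :
    split Γ v ((u, e) :: l) =
      (⟨gen Γ u, gen_mem_par (Set.mem_compl_singleton_iff.2 h)⟩ ^ (e : ℤ) * (split Γ v l).1,
        (split Γ v l).2) := by
  simp [split, h]

theorem of_split_mul_syllables (v : V) (l : List (V × ℤˣ)) :
    of (split Γ v l).1 * syllables (link Γ v) (split Γ v l).2 = toHNN Γ v (eval Γ l) := by
  induction l with
  | nil => simp [split]
  | cons p l ih =>
    obtain ⟨u, e⟩ := p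
    by_cases h : u = v
    · subst h
      simp [split_cons_self, ← ih, mul_assoc]
    · simp [split_cons_of_ne h, ← ih, mul_assoc, toHNN_gen_of_ne h]

theorem split_concat (v : V) (e : ℤˣ) (l : List (V × ℤˣ)) :
    split Γ v (l ++ [(v, e)]) = ((split Γ v l).1, (split Γ v l).2 ++ [(e, 1)]) := by
  induction l with
  | nil => simp [split]
  | cons p l ih =>
    obtain ⟨u, f⟩ := p
    by_cases h : u = v
    · subst h
      simp [split_cons_self, ih]
    · simp [split_cons_of_ne h, ih]

theorem exists_eq_append_of_split_eq_cons {v : V} {l : List (V × ℤˣ)} {x : ℤˣ × par Γ {v}ᶜ}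
    (h : x ∈ (split Γ v l).2.head?) :
    ∃ l₁ l₂, l = l₁ ++ (v, x.1) :: l₂ ∧ eval Γ l₁ = (split Γ v l).1 := by
  induction l with
  | nil => simp [split] at h
  | cons p l ih =>
    obtain ⟨u, e⟩ := p
    by_cases hu : u = v
    · subst hu
      rw [split_cons_self] at h ⊢
      obtain rfl : (e, (split Γ u l).1) = x := by simpa using h
      exact ⟨[], l, rfl, rfl⟩
    · rw [split_cons_of_ne hu] at h ⊢
      obtain ⟨l₁, l₂, rfl, h'⟩ := ih h
      exact ⟨(u, e) :: l₁, l₂, rfl, by simp [h']⟩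

theorem noPinch_split {v : V} {l : List (V × ℤˣ)}
    (h : ∀ l₀ l₁ l₂ e, l = l₀ ++ (v, e) :: (l₁ ++ (v, -e) :: l₂) →
      eval Γ l₁ ∉ par Γ (Γ.neighborSet v)) :
    NoPinch (link Γ v) (split Γ v l).2 := by
  induction l with
  | nil => simp [split, NoPinch]
  | cons p l ih =>
    obtain ⟨u, e⟩ := p
    specialize ih fun l₀ l₁ l₂ f hl => h ((u, e) :: l₀) l₁ l₂ f (by rw [hl]; rfl)
    by_cases hu : u = v
    · subst hu
      rw [split_cons_self]
      refine List.isChain_cons.2 ⟨fun y hy hA => ?_, ih⟩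
      obtain ⟨l₁, l₂, hl, h'⟩ := exists_eq_append_of_split_eq_cons hy
      by_contra hne
      have hy1 : y.1 = -e := by
        change ¬ e = y.1 at hne
        rcases Int.units_eq_one_or e with rfl | rfl <;>
        rcases Int.units_eq_one_or y.1 with h | h <;> simp_all
      refine h [] l₁ l₂ e (by rw [hl, hy1]; rfl) ?_
      rw [h']
      exact Subgroup.mem_subgroupOf.1 hA
    · rw [split_cons_of_ne hu]
      exact ih

/-- A word of minimal length among the words spelling a conjugate of the same element. -/
def IsCyclicallyReduced (Γ : SimpleGraph V) (l : List (V × ℤˣ)) : Prop :=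
  ∀ l' g, eval Γ l' = g * eval Γ l * g⁻¹ → l.length ≤ l'.length

theorem exists_isCyclicallyReduced (a : RAAG Γ) :
    ∃ l g, IsCyclicallyReduced Γ l ∧ eval Γ l = g * a * g⁻¹ := by
  obtain ⟨l₀, hl₀⟩ := eval_surjective a
  obtain ⟨l, ⟨g, hg⟩, hmin⟩ := exists_minimalFor_of_wellFoundedLT
    (fun l : List (V × ℤˣ) => ∃ g, eval Γ l = g * a * g⁻¹) List.length ⟨l₀, 1, by simp [hl₀]⟩
  refine ⟨l, g, fun l' g' h => ?_, hg⟩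
  by_contra! hlt
  refine hlt.not_ge (hmin (j := l') ⟨g' * g, ?_⟩ hlt.le)
  rw [h, hg]
  group

theorem IsCyclicallyReduced.rotate {l₁ l₂ : List (V × ℤˣ)}
    (h : IsCyclicallyReduced Γ (l₁ ++ l₂)) : IsCyclicallyReduced Γ (l₂ ++ l₁) := by
  intro l' g hg
  have := h l' (g * (eval Γ l₁)⁻¹) (by rw [hg, eval_append, eval_append]; group)
  simpa [add_comm] using this

/-- A pinch could be deleted, giving a word shorter by two letters for a conjugate. The appended
letter also detects pinches across the cyclic seam. -/
theorem IsCyclicallyReduced.noPinch {v : V} {e : ℤˣ} {l : List (V × ℤˣ)}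
    (h : IsCyclicallyReduced Γ ((v, e) :: l)) :
    NoPinch (link Γ v) (split Γ v ((v, e) :: l ++ [(v, e)])).2 := by
  refine noPinch_split fun l₀ l₁ l₂ f hl hmem => ?_
  have hc : Commute (eval Γ l₁) (gen Γ v ^ (f : ℤ)) :=
    (commute_gen_of_mem_par_neighborSet hmem).zpow_right _
  rcases l₂.eq_nil_or_concat' with rfl | ⟨l₂, x, rfl⟩
  · rw [← List.cons_append, ← List.append_assoc] at hl
    obtain ⟨hl, hx⟩ := List.append_inj' hl rfl
    obtain rfl : e = -f := by simpa using hx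
    cases l₀ with
    | nil =>
      have : -f = f := by simpa using congrArg Prod.snd (List.cons.inj hl).1
      rcases Int.units_eq_one_or f with rfl | rfl <;> simp at this
    | cons y l₀ =>
      obtain ⟨rfl, rfl⟩ := List.cons.inj hl
      -- The pinch ends at the appended letter; conjugating by `v ^ f` moves the initial `v ^ (-f)`
      -- to the end, where it cancels.
      have := h (l₀ ++ l₁) (gen Γ v ^ (f : ℤ)) (by
        change _ = _ * eval Γ ((v, -f) :: (l₀ ++ (v, f) :: l₁)) * _
        simp only [eval_cons, eval_append, ← hc.eq, Units.val_neg, zpow_neg]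
        group)
      simp at this
  · rw [← List.cons_append, ← List.append_assoc, ← List.cons_append, ← List.append_assoc] at hl
    obtain ⟨hl, -⟩ := List.append_inj' hl rfl
    have := h (l₀ ++ (l₁ ++ l₂)) 1 (by
      rw [hl]
      simp only [eval_cons, eval_append, Units.val_neg, zpow_neg, ← mul_assoc]
      rw [mul_assoc _ _ (eval Γ l₁), ← hc.eq]
      group)
    rw [hl] at this
    simp at this

theorem IsCyclicallyReduced.exists_pow_mul_zpow_mem {v : V} {e : ℤˣ} {l : List (V × ℤˣ)}
    (h : IsCyclicallyReduced Γ ((v, e) :: l)) {c : RAAG Γ}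
    (hc : Commute c (eval Γ ((v, e) :: l))) :
    ∃ n : ℕ, 0 < n ∧ ∃ k : ℤ,
      c ^ n * eval Γ ((v, e) :: l) ^ k ∈ par Γ (Γ.neighborSet v) := by
  have hnp := h.noPinch
  have hs := of_split_mul_syllables (Γ := Γ) v ((v, e) :: l)
  rw [split_concat] at hnp
  rw [split_cons_self] at hnp hs
  simp only [map_one, one_mul] at hs
  obtain ⟨n, hn, k, g, hg, hk⟩ := HNNExtension.exists_pow_mul_zpow_mem
    (x := (e, (split Γ v l).1)) hnp (c := toHNN Γ v c) (by
      rw [hs]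
      exact hc.map _)
  refine ⟨n, hn, k, ?_⟩
  rw [hs, ← map_pow, ← map_zpow, ← map_mul, ← toHNN_coe] at hk
  rw [toHNN_injective v hk]
  exact Subgroup.mem_subgroupOf.1 hg

/-- If `b` commuted with every letter it would commute with the whole word. The conjugation by `eval
Γ l₁` matches the rotation of the word that brings `v` to the front. -/
theorem exists_conj_not_commute_gen {l : List (V × ℤˣ)} {b : RAAG Γ}
    (h : ¬ Commute b (eval Γ l)) :
    ∃ l₁ v e l₂, l = l₁ ++ (v, e) :: l₂ ∧
      ¬ Commute ((eval Γ l₁)⁻¹ * b * eval Γ l₁) (gen Γ v) := by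
  induction l generalizing b with
  | nil => simp at h
  | cons p l ih =>
    obtain ⟨u, e⟩ := p
    by_cases hu : Commute b (gen Γ u)
    · have hu' := hu.zpow_right e
      obtain ⟨l₁, v, f, l₂, rfl, h'⟩ := ih (b := b) fun h' => h (by
        rw [eval_cons]
        exact hu'.mul_right h')
      refine ⟨(u, e) :: l₁, v, f, l₂, rfl, ?_⟩
      convert h' using 1
      rw [eval_cons, mul_inv_rev, mul_assoc _ _ b, ← hu'.inv_right.eq]
      simp [mul_assoc]
    · exact ⟨[], u, e, l, rfl, by simpa using hu⟩

theorem exists_conj_forall_pow_mul_zpow_mem {a b : RAAG Γ} (h : ¬ Commute b a) :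
    ∃ g v, ¬ Commute (g * b * g⁻¹) (gen Γ v) ∧ ∀ c, Commute c (g * a * g⁻¹) →
      ∃ n : ℕ, 0 < n ∧ ∃ k : ℤ, c ^ n * (g * a * g⁻¹) ^ k ∈ par Γ (Γ.neighborSet v) := by
  obtain ⟨l, g, hl, hg⟩ := exists_isCyclicallyReduced a
  rw [← commute_conj_iff g, ← hg] at h
  obtain ⟨l₁, v, e, l₂, rfl, h'⟩ := exists_conj_not_commute_gen h
  have ha : (eval Γ l₁)⁻¹ * g * a * ((eval Γ l₁)⁻¹ * g)⁻¹ = eval Γ ((v, e) :: (l₂ ++ l₁)) := by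
    have : a = g⁻¹ * eval Γ (l₁ ++ (v, e) :: l₂) * g := by rw [hg]; group
    rw [this]
    simp only [eval_append, eval_cons]
    group
  refine ⟨(eval Γ l₁)⁻¹ * g, v, ?_, fun c hc => ?_⟩
  · convert h' using 1
    group
  · rw [ha] at hc ⊢
    exact hl.rotate.exists_pow_mul_zpow_mem hc

/-! ### Commutators, and noncommutation in the free group via `SL₂(ℤ)`. -/

theorem commutatorElement_mul_mul {G : Type*} [Group G] {x y z w : G} (hxw : Commute x w)
    (hzy : Commute z y) (hzw : Commute z w) : ⁅x * z, y * w⁆ = ⁅x, y⁆ := by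
  have h₁ : z * (y * w) * z⁻¹ = y * w := by rw [(hzy.mul_right hzw).eq]; group
  have h₂ : w * x⁻¹ * w⁻¹ = x⁻¹ := by rw [← hxw.inv_left.eq]; group
  calc ⁅x * z, y * w⁆ = x * (z * (y * w) * z⁻¹) * x⁻¹ * (y * w)⁻¹ := by
        rw [commutatorElement_def]; group
    _ = x * y * (w * x⁻¹ * w⁻¹) * y⁻¹ := by rw [h₁]; group
    _ = ⁅x, y⁆ := by rw [h₂, commutatorElement_def]

/-- The upper unitriangular matrix with entry `p`. -/
def upper (p : ℤ) : Matrix.SpecialLinearGroup (Fin 2) ℤ := ⟨!![1, p; 0, 1], by simp⟩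

/-- The lower unitriangular matrix with entry `p`. -/
def lower (p : ℤ) : Matrix.SpecialLinearGroup (Fin 2) ℤ := ⟨!![1, 0; p, 1], by simp⟩

@[simp]
theorem coe_upper (p : ℤ) : (upper p : Matrix (Fin 2) (Fin 2) ℤ) = !![1, p; 0, 1] := rfl

@[simp]
theorem coe_lower (p : ℤ) : (lower p : Matrix (Fin 2) (Fin 2) ℤ) = !![1, 0; p, 1] := rfl

theorem upper_pow (n : ℕ) : upper 1 ^ n = upper n := by
  induction n with
  | zero => ext i j; fin_cases i <;> fin_cases j <;> simp
  | succ n ih =>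
    rw [pow_succ, ih]
    ext i j; fin_cases i <;> fin_cases j <;> simp [add_comm]

theorem lower_pow (n : ℕ) : lower 1 ^ n = lower n := by
  induction n with
  | zero => ext i j; fin_cases i <;> fin_cases j <;> simp
  | succ n ih =>
    rw [pow_succ, ih]
    ext i j; fin_cases i <;> fin_cases j <;> simp

theorem coe_commutatorElement_upper_lower (p q : ℤ) :
    ((⁅upper p, lower q⁆ : Matrix.SpecialLinearGroup (Fin 2) ℤ) : Matrix (Fin 2) (Fin 2) ℤ) =
      !![1 + p * q + p ^ 2 * q ^ 2, -p ^ 2 * q; p * q ^ 2, 1 - p * q] := by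
  rw [commutatorElement_def]
  simp only [Matrix.SpecialLinearGroup.coe_mul, Matrix.SpecialLinearGroup.coe_inv, coe_upper, coe_lower,
    Matrix.adjugate_fin_two_of, Matrix.mul_fin_two]
  ext i j; fin_cases i <;> fin_cases j <;> simp <;> ring

theorem upper_inv (p : ℤ) : (upper p)⁻¹ = upper (-p) := by
  ext i j; fin_cases i <;> fin_cases j <;> simp [Matrix.adjugate_fin_two_of]

/-- In `SL₂(ℤ)`, the top left entries of the two products differ by `2 * n ^ 3 * m ^ 3`. No
faithfulness of the representation is needed. -/
theorem not_commute_commutatorElement_of {n m : ℕ} (hn : 0 < n) (hm : 0 < m) :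
    ¬ Commute ⁅(FreeGroup.of (0 : Fin 2)) ^ n, (FreeGroup.of (1 : Fin 2)) ^ m⁆
      ⁅((FreeGroup.of (0 : Fin 2)) ^ n)⁻¹, (FreeGroup.of (1 : Fin 2)) ^ m⁆ := by
  intro h
  have h' := h.map (FreeGroup.lift ![upper 1, lower 1])
  simp only [map_commutatorElement, map_pow, map_inv, FreeGroup.lift_apply_of, Matrix.cons_val_zero,
    Matrix.cons_val_one, upper_pow, lower_pow, upper_inv] at h'
  have h'' := congrArg (fun M : Matrix.SpecialLinearGroup (Fin 2) ℤ =>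
    (M : Matrix (Fin 2) (Fin 2) ℤ) 0 0) h'.eq
  simp only [Matrix.SpecialLinearGroup.coe_mul, coe_commutatorElement_upper_lower,
    Matrix.mul_fin_two] at h''
  have hn' : (n : ℤ) ≠ 0 := by exact_mod_cast hn.ne'
  have hm' : (m : ℤ) ≠ 0 := by exact_mod_cast hm.ne'
  have : (n : ℤ) ^ 3 * m ^ 3 ≠ 0 := mul_ne_zero (pow_ne_zero _ hn') (pow_ne_zero _ hm')
  simp at h''
  apply this
  linarith

/-! ### The two halves of the theorem. -/

theorem isIndContained_of_injective [Finite V] (f : FreeGroup (Fin 2) × FreeGroup (Fin 2) →* RAAG Γ)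
    (hf : Function.Injective f) : (SimpleGraph.cycleGraph 4).IsIndContained Γ := by
  set x : FreeGroup (Fin 2) := FreeGroup.of 0
  set y : FreeGroup (Fin 2) := FreeGroup.of 1
  have hxy : ¬ Commute y x := fun h =>
    not_commute_commutatorElement_of one_pos one_pos (by
      have : ⁅x ^ 1, y ^ 1⁆ = 1 := by
        rw [pow_one, pow_one, commutatorElement_eq_one_iff_commute]; exact h.symm
      rw [this]
      exact Commute.one_left _)
  obtain ⟨g, v, hb, key⟩ := exists_conj_forall_pow_mul_zpow_mem
    (a := f (x, 1)) (b := f (y, 1)) (fun h => hxy (by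
      have := h.of_map hf
      exact congrArg Prod.fst this.eq))
  let F := (MulAut.conj g).toMonoidHom.comp f
  have hF : Function.Injective F := (MulAut.conj g).injective.comp hf
  have hcomm : ∀ p q, Commute (F (1, q)) (F (p, 1)) := fun p q =>
    Commute.map (show (1, q) * (p, 1) = (p, 1) * (1, q) by simp) F
  change ¬ Commute (F (y, 1)) _ at hb
  change ∀ c, Commute c (F (x, 1)) → ∃ n : ℕ, 0 < n ∧ ∃ k : ℤ, c ^ n * F (x, 1) ^ k ∈ _ at key
  obtain ⟨n, hn, k, hk⟩ := key (F (1, x)) (hcomm _ _)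
  obtain ⟨m, hm, j, hj⟩ := key (F (1, y)) (hcomm _ _)
  have hz : ∀ k : ℤ, ((x, 1) : FreeGroup (Fin 2) × FreeGroup (Fin 2)) ^ k = (x ^ k, 1) :=
    fun k => Prod.ext rfl (one_zpow k)
  simp only [← map_pow, ← map_zpow, Prod.pow_mk, one_pow, hz] at hk hj
  have hpow : ∀ k j : ℤ, Commute (F (x ^ k, 1)) (F (x ^ j, 1)) := fun k j => by
    rw [← hz, ← hz]
    exact ((Commute.refl _).zpow_zpow k j).map F
  -- The factors `F (x ^ k, 1)` and `F (x ^ j, 1)` need not commute with `F (y, 1)`; taking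
  -- commutators removes them while staying in the link subgroup.
  have e₁ : ⁅F (1, x ^ n) * F (x ^ k, 1), F (1, y ^ m) * F (x ^ j, 1)⁆ =
      F (1, ⁅x ^ n, y ^ m⁆) := by
    rw [commutatorElement_mul_mul (hcomm _ _) (hcomm _ _).symm
      (hpow _ _), ← map_commutatorElement]
    simp [commutatorElement_def]
  have e₂ : ⁅(F (1, x ^ n) * F (x ^ k, 1))⁻¹, F (1, y ^ m) * F (x ^ j, 1)⁆ =
      F (1, ⁅(x ^ n)⁻¹, y ^ m⁆) := by
    rw [← map_mul F, ← map_inv]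
    have : ((1, x ^ n) * (x ^ k, 1) : FreeGroup (Fin 2) × FreeGroup (Fin 2))⁻¹ =
      (1, (x ^ n)⁻¹) * (x ^ (-k), 1) := by simp
    rw [this, map_mul, commutatorElement_mul_mul (hcomm _ _) (hcomm _ _).symm
      (hpow _ _), ← map_commutatorElement]
    simp [commutatorElement_def]
  have mem : ∀ {p q : RAAG Γ} {H : Subgroup (RAAG Γ)}, p ∈ H → q ∈ H → ⁅p, q⁆ ∈ H :=
    fun hp hq => mul_mem (mul_mem (mul_mem hp hq) (inv_mem hp)) (inv_mem hq)
  obtain ⟨v', w, w', h₁, h₂, h₃, h₄, h₅, h₆, h₇, h₈⟩ := exists_square hb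
    (e₁ ▸ mem hk hj) (e₂ ▸ mem (inv_mem hk) hj)
    (fun h => not_commute_commutatorElement_of hn hm (by
      have := h.of_map hF
      exact congrArg Prod.snd this.eq))
    (hcomm _ _).symm (hcomm _ _).symm
  have hinj : Function.Injective ![v, w, v', w'] := by
    intro i j hij
    fin_cases i <;> fin_cases j <;>
      simp_all [h₅.ne, h₆.ne, h₇.ne, h₈.ne, h₅.ne', h₆.ne', h₇.ne', h₈.ne', Ne.symm]
  refine ⟨⟨⟨_, hinj⟩, fun {i j} => ?_⟩⟩
  fin_cases i <;> fin_cases j <;>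
    simp [SimpleGraph.cycleGraph_adj, h₂, h₄, h₅, h₆, h₇, h₈, h₅.symm, h₆.symm, h₇.symm, h₈.symm,
      Γ.adj_comm v' v, Γ.adj_comm w' w] <;> decide

theorem nonempty_mulEquiv_cycleGraph_four :
    Nonempty ((FreeGroup (Fin 2) × FreeGroup (Fin 2)) ≃* RAAG (SimpleGraph.cycleGraph 4)) := by
  have hadj : ∀ i j : Fin 2, (SimpleGraph.cycleGraph 4).Adj (![0, 2] i) (![1, 3] j) := by decide
  let φ₁ : FreeGroup (Fin 2) →* RAAG (SimpleGraph.cycleGraph 4) :=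
    FreeGroup.lift fun i => gen (SimpleGraph.cycleGraph 4) (![0, 2] i)
  let φ₂ : FreeGroup (Fin 2) →* RAAG (SimpleGraph.cycleGraph 4) :=
    FreeGroup.lift fun i => gen (SimpleGraph.cycleGraph 4) (![1, 3] i)
  have hφ : ∀ p q, Commute (φ₁ p) (φ₂ q) := by
    intro p q
    have h₁ : ∀ i, Commute (φ₁ p) (gen (SimpleGraph.cycleGraph 4) (![1, 3] i)) := by
      intro i
      induction p using FreeGroup.induction_on with
      | C1 => simp
      | of j => simpa [φ₁] using commute_gen (hadj j i)
      | inv_of j h => simpa using h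
      | mul p p' h h' => simpa using h.mul_left h'
    induction q using FreeGroup.induction_on with
    | C1 => simp
    | of j => simpa [φ₂] using h₁ j
    | inv_of j h => simpa using h
    | mul p p' h h' => simpa using h.mul_right h'
  let o : Fin 2 → FreeGroup (Fin 2) := FreeGroup.of
  let ψ : RAAG (SimpleGraph.cycleGraph 4) →* FreeGroup (Fin 2) × FreeGroup (Fin 2) :=
    lift ![(o 0, 1), (1, o 0), (o 1, 1), (1, o 1)] (by
      intro i j h
      fin_cases i <;> fin_cases j <;> first
        | (exfalso; revert h; decide)
        | simp [Commute, SemiconjBy])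
  -- The factors correspond to the opposite pairs `{0, 2}` and `{1, 3}`.
  refine ⟨MonoidHom.toMulEquiv (MonoidHom.noncommCoprod φ₁ φ₂ hφ) ψ ?_ ?_⟩
  · apply MonoidHom.ext
    have hψ₁ : ψ.comp φ₁ = MonoidHom.inl _ _ := FreeGroup.ext_hom _ _ fun i => by
      fin_cases i <;> simp [φ₁, ψ, o]
    have hψ₂ : ψ.comp φ₂ = MonoidHom.inr _ _ := FreeGroup.ext_hom _ _ fun i => by
      fin_cases i <;> simp [φ₂, ψ, o]
    rintro ⟨p, q⟩
    have h₁ := DFunLike.congr_fun hψ₁ p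
    have h₂ := DFunLike.congr_fun hψ₂ q
    simp at h₁ h₂
    simp [h₁, h₂]
  · refine hom_ext fun i => ?_
    fin_cases i <;> simp [φ₁, φ₂, ψ, o]

end RAAG

theorem corollaryc {V : Type*} [Finite V] (Γ : SimpleGraph V) :
    Nonempty ((FreeGroup (Fin 2) × FreeGroup (Fin 2)) ≃* RAAG (SimpleGraph.cycleGraph 4)) ∧
      ((∃ f : RAAG (SimpleGraph.cycleGraph 4) →* RAAG Γ, Function.Injective f) →
        (SimpleGraph.cycleGraph 4).IsIndContained Γ) := by
  refine ⟨RAAG.nonempty_mulEquiv_cycleGraph_four, ?_⟩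
  rintro ⟨f, hf⟩
  obtain ⟨e⟩ := RAAG.nonempty_mulEquiv_cycleGraph_four
  exact RAAG.isIndContained_of_injective (f.comp e.toMonoidHom) (hf.comp e.injective)
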